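/- Let $d$ and $p$ be integers with $0<p<d-2$. Let $(M,g)$ be a smooth $d$-dimensional spacetime, i.e. a smooth manifold with a smooth metric of signature $(-,+,\dots,+)$ and Levi-Civita connection $\nabla$. Let $\ell$ be a smooth null vector field on $M$ (nowhere zero, $g(\ell,\ell)=0$), and let $F$ be a smooth $(p+1)$-form on $M$ satisfying the source-free Maxwell equations $$\nabla^{\mu}F_{\mu\nu_1\dots\nu_p}=0,\qquad \nabla_{[\nu_1}F_{\nu_2\dots\nu_{p+2}]}=0 .$$ A null frame at a point is a basis $e_0=\ell,\ e_1=n,\ e_i=m_i$ ($2\le i\le d-1$) of the tangent space whose only non-vanishing scalar products are $\ell\cdot n=1$ and $m_i\cdot m_j=\delta_{ij}$; the boost weight of a frame component $F_{a_0\dots a_p}$ is the number of its indices equal to $0$ minus the number equal to $1$. Suppose that $\ell$ is multiply aligned with $F$: at every point of $M$ all components of $F$ of non-negative boost weight vanish in a null frame containing $\ell$ (this does not depend on the choice of $n$ and $m_i$). Then at every point of $M$ at which $F\neq 0$ the following hold. (i) $\ell$ is geodesic: $\nabla_\ell\ell$ is a multiple of $\ell$. (ii) In every null frame containing $\ell$,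 let $\rho_{ij}=m_i^\mu m_j^\nu\nabla_\nu\ell_\mu$ be the optical matrix and $\rho=\rho_{ii}$ its trace. Then, among the $d-2$ eigenvalues of the symmetric part $\rho_{(ij)}$, counted with multiplicity, there are $p$ whose sum is $\rho/2$, and the remaining $d-2-p$ also sum to $\rho/2$. (iii) If $p=1$, then moreover, with $\varphi'_i=F(n,m_i)$: the vector $\varphi'$ is non-zero and is an eigenvector of $\rho_{(ij)}$ with eigenvalue $\rho/2$, and there are real numbers $\omega_i$ with $\rho_{[ij]}=\varphi'_{[i}\omega_{j]}$, where $\rho_{[ij]}=\tfrac12(\rho_{ij}-\rho_{ji})$ and $\varphi'_{[i}\omega_{j]}=\tfrac12(\varphi'_i\omega_j-\varphi'_j\omega_i)$. -/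

import Mathlib

open scoped Manifold ContDiff Bundle

noncomputable section

namespace NullAlign

/-! ### Tensor calculus in one coordinate chart

Points, vectors, bilinear forms and `k`-forms of an open set of `ℝ^d`. -/

/-- The coordinate space `ℝ^d`. -/
abbrev Coord (d : ℕ) : Type := EuclideanSpace ℝ (Fin d)

/-- Bilinear forms on the coordinate space. -/
abbrev Bil (d : ℕ) : Type := Coord d →L[ℝ] Coord d →L[ℝ] ℝ

/-- Alternating `k`-linear forms on the coordinate space. -/
abbrev Alt (d k : ℕ) : Type := Coord d [⋀^Fin k]→L[ℝ] ℝ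

/-- The coordinate vector `∂_μ`. -/
def coordVec (d : ℕ) (μ : Fin d) : Coord d := EuclideanSpace.single μ 1

/-- The matrix `g_{μν}` of a bilinear form in the coordinate basis. -/
def gram {d : ℕ} (b : Bil d) : Matrix (Fin d) (Fin d) ℝ :=
  Matrix.of fun μ ν => b (coordVec d μ) (coordVec d ν)

/-- Christoffel symbols of the first kind, contracted with vectors:
`½ (∂_u g(v, w) + ∂_v g(u, w) - ∂_w g(u, v))`. -/
def christoffelFirst {d : ℕ} (G : Coord d → Bil d) (y u v w : Coord d) : ℝ :=
  (1 / 2 : ℝ) * (fderiv ℝ G y u v w + fderiv ℝ G y v u w - fderiv ℝ G y w u v)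

/-- Christoffel symbols of the second kind: the vector `Γ(u, v)` with components
`Γ^λ_{μν} u^μ v^ν`, where `Γ^λ_{μν} = g^{λσ} Γ_{σμν}`. -/
def christoffel {d : ℕ} (G : Coord d → Bil d) (y u v : Coord d) : Coord d :=
  ∑ l, (∑ s, (gram (G y))⁻¹ l s * christoffelFirst G y u v (coordVec d s)) • coordVec d l

/-- Levi-Civita derivative of a vector field: `∇_u Y = ∂_u Y + Γ(u, Y)`. -/
def nablaVec {d : ℕ} (G : Coord d → Bil d) (Y : Coord d → Coord d) (y u : Coord d) : Coord d :=
  fderiv ℝ Y y u + christoffel G y u (Y y)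

/-- Levi-Civita derivative of a form:
`(∇_u F)(v₁, …, v_k) = (∂_u F)(v₁, …, v_k) - ∑ᵢ F(v₁, …, Γ(u, vᵢ), …, v_k)`. -/
def nablaForm {d k : ℕ} (G : Coord d → Bil d) (F : Coord d → Alt d k) (y u : Coord d)
    (v : Fin k → Coord d) : ℝ :=
  fderiv ℝ F y u v - ∑ i, F y (Function.update v i (christoffel G y u (v i)))

/-- Divergence `∇^μ F_{μ ν₁ … ν_p}`, contracted with `p` vectors. -/
def divForm {d p : ℕ} (G : Coord d → Bil d) (F : Coord d → Alt d (p + 1)) (y : Coord d)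
    (v : Fin p → Coord d) : ℝ :=
  ∑ μ, ∑ ν, (gram (G y))⁻¹ μ ν *
    nablaForm G F y (coordVec d μ) (Fin.cons (coordVec d ν) v : Fin (p + 1) → Coord d)

/-- The antisymmetrised derivative of a form, contracted with `k + 1` vectors:
`∑ᵢ (-1)^i (∇_{vᵢ} F)(v₀, …, v̂ᵢ, …, v_k)`. As `F` is alternating, this is
`(k + 1) ∇_{[ν₀} F_{ν₁ … ν_k]}`, the antisymmetrisation being normalised by `1 / (k + 1)!`. -/
def curlForm {d k : ℕ} (G : Coord d → Bil d) (F : Coord d → Alt d k) (y : Coord d)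
    (v : Fin (k + 1) → Coord d) : ℝ :=
  ∑ i : Fin (k + 1), (-1 : ℝ) ^ (i : ℕ) * nablaForm G F y (v i) (fun j => v (i.succAbove j))

/-! ### Fields on a manifold and their coordinate expressions -/

section Manifold

variable {d : ℕ} {M : Type*} [TopologicalSpace M] [ChartedSpace (Coord d) M]

/-- The coordinate basis map `ℝ^d → T_{φ⁻¹ y} M` of the chart `φ` around `x₀`, i.e. the
derivative of `φ⁻¹` at `y`. -/
def chartTangent (x₀ : M) (y : Coord d) :
    Coord d →L[ℝ] TangentSpace (𝓡 d) ((extChartAt (𝓡 d) x₀).symm y) :=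
  mfderiv 𝓘(ℝ, Coord d) (𝓡 d) (extChartAt (𝓡 d) x₀).symm y

/-- Coordinate expression of a field of bilinear forms in the chart around `x₀`. -/
def bilInChart (g : ∀ x : M, TangentSpace (𝓡 d) x →L[ℝ] TangentSpace (𝓡 d) x →L[ℝ] ℝ)
    (x₀ : M) (y : Coord d) : Bil d :=
  (ContinuousLinearMap.precomp ℝ (chartTangent x₀ y)).comp
    ((g ((extChartAt (𝓡 d) x₀).symm y)).comp (chartTangent x₀ y))

/-- Coordinate expression of a vector field in the chart around `x₀`. -/
def vecInChart (Y : ∀ x : M, TangentSpace (𝓡 d) x) (x₀ : M) (y : Coord d) : Coord d :=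
  mfderiv (𝓡 d) 𝓘(ℝ, Coord d) (extChartAt (𝓡 d) x₀) ((extChartAt (𝓡 d) x₀).symm y)
    (Y ((extChartAt (𝓡 d) x₀).symm y))

/-- Coordinate expression of a `k`-form field in the chart around `x₀`. -/
def formInChart {k : ℕ} (F : ∀ x : M, TangentSpace (𝓡 d) x [⋀^Fin k]→L[ℝ] ℝ)
    (x₀ : M) (y : Coord d) : Alt d k :=
  (F ((extChartAt (𝓡 d) x₀).symm y)).compContinuousLinearMap (chartTangent x₀ y)

/-- Smoothness of a vector field. -/
def SmoothVec [IsManifold (𝓡 d) ∞ M] (Y : ∀ x : M, TangentSpace (𝓡 d) x) : Prop :=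
  ContMDiff (𝓡 d) ((𝓡 d).prod 𝓘(ℝ, Coord d)) ∞
    (fun x => (Bundle.TotalSpace.mk' (Coord d) x (Y x) : TangentBundle (𝓡 d) M))

/-- Smoothness of a field of bilinear forms. -/
def SmoothBil [IsManifold (𝓡 d) ∞ M]
    (g : ∀ x : M, TangentSpace (𝓡 d) x →L[ℝ] TangentSpace (𝓡 d) x →L[ℝ] ℝ) : Prop :=
  ContMDiff (𝓡 d) ((𝓡 d).prod 𝓘(ℝ, Bil d)) ∞
    (fun x => Bundle.TotalSpace.mk' (Bil d)
      (E := fun x : M => TangentSpace (𝓡 d) x →L[ℝ] TangentSpace (𝓡 d) x →L[ℝ] ℝ) x (g x))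

/-- Smoothness of a `k`-form field. -/
def SmoothForm [IsManifold (𝓡 d) ∞ M] {k : ℕ}
    (F : ∀ x : M, TangentSpace (𝓡 d) x [⋀^Fin k]→L[ℝ] ℝ) : Prop :=
  ContMDiff (𝓡 d) ((𝓡 d).prod 𝓘(ℝ, Alt d k)) ∞
    (fun x => Bundle.TotalSpace.mk' (Alt d k)
      (E := fun x : M => TangentSpace (𝓡 d) x [⋀^Fin k]→L[ℝ] Bundle.Trivial M ℝ x) x (F x))

end Manifold

/-- A smooth Lorentzian metric on a `d`-dimensional manifold: a smooth field of symmetric bilinear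
forms on the tangent spaces, of signature `(-, +, …, +)` at every point. -/
structure LorentzMetric (d : ℕ) (M : Type*) [TopologicalSpace M] [ChartedSpace (Coord d) M]
    [IsManifold (𝓡 d) ∞ M] where
  /-- The scalar product on each tangent space. -/
  val : ∀ x : M, TangentSpace (𝓡 d) x →L[ℝ] TangentSpace (𝓡 d) x →L[ℝ] ℝ
  symm : ∀ (x : M) (u v : TangentSpace (𝓡 d) x), val x u v = val x v u
  signature : ∀ x : M, ∃ b : Module.Basis (Fin d) ℝ (TangentSpace (𝓡 d) x), ∀ i j,
    val x (b i) (b j) = if i = j then (if (i : ℕ) = 0 then -1 else 1) else 0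
  smooth : SmoothBil val

section Spacetime

variable {d : ℕ} {M : Type*} [TopologicalSpace M] [ChartedSpace (Coord d) M]
  [IsManifold (𝓡 d) ∞ M]

/-- The Levi-Civita derivative `∇_u Y` at the point `x`, computed in the chart around `x`. (The
tangent space at `x` is by definition the coordinate space of that chart, so that the coordinate
vector of `u` is `u` itself.) -/
def nabla (g : LorentzMetric d M) (Y : ∀ x : M, TangentSpace (𝓡 d) x) (x : M)
    (u : TangentSpace (𝓡 d) x) : TangentSpace (𝓡 d) x :=
  nablaVec (bilInChart g.val x) (vecInChart Y x) (extChartAt (𝓡 d) x x) u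

/-- The source-free Maxwell equations for a field strength `F` of degree `p + 1`:
`∇^μ F_{μ ν₁ … ν_p} = 0` and `∇_{[ν₁} F_{ν₂ … ν_{p+2}]} = 0` at every point. -/
structure IsMaxwell {p : ℕ} (g : LorentzMetric d M)
    (F : ∀ x : M, TangentSpace (𝓡 d) x [⋀^Fin (p + 1)]→L[ℝ] ℝ) : Prop where
  smooth : SmoothForm F
  div_eq_zero : ∀ (x : M) (v : Fin p → Coord d),
    divForm (bilInChart g.val x) (formInChart F x) (extChartAt (𝓡 d) x x) v = 0
  curl_eq_zero : ∀ (x : M) (v : Fin (p + 2) → Coord d),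
    curlForm (bilInChart g.val x) (formInChart F x) (extChartAt (𝓡 d) x x) v = 0

/-- A smooth null vector field: nowhere zero and of vanishing norm. -/
structure IsNullField (g : LorentzMetric d M) (l : ∀ x : M, TangentSpace (𝓡 d) x) : Prop where
  smooth : SmoothVec l
  ne_zero : ∀ x : M, l x ≠ 0
  null : ∀ x : M, g.val x (l x) (l x) = 0

/-- A null frame `{l, n, m_i}` of the tangent space at `x` whose first vector is the given `l`. -/
structure NullFrame (g : LorentzMetric d M) (x : M) (l : TangentSpace (𝓡 d) x) where
  /-- The second null vector. -/
  n : TangentSpace (𝓡 d) x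
  /-- The spacelike vectors. -/
  m : Fin (d - 2) → TangentSpace (𝓡 d) x
  l_l : g.val x l l = 0
  n_n : g.val x n n = 0
  l_n : g.val x l n = 1
  l_m : ∀ i, g.val x l (m i) = 0
  n_m : ∀ i, g.val x n (m i) = 0
  m_m : ∀ i j, g.val x (m i) (m j) = if i = j then 1 else 0

/-- Frame indices: the indices `0` and `1` of the null vectors, and the `d - 2` spatial ones. -/
abbrev FrameIndex (d : ℕ) : Type := Fin 2 ⊕ Fin (d - 2)

/-- Boost weight of a lowered frame index: `1` for the index `0`, `-1` for the index `1`, and `0`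
for a spatial index. -/
def indexBoost : FrameIndex d → ℤ := Sum.elim ![1, -1] (fun _ => 0)

namespace NullFrame

variable {g : LorentzMetric d M} {x : M} {l : TangentSpace (𝓡 d) x}

/-- The frame vectors `e_0 = l`, `e_1 = n`, `e_i = m_i`. -/
def vec (e : NullFrame g x l) : FrameIndex d → TangentSpace (𝓡 d) x := Sum.elim ![l, e.n] e.m

end NullFrame

/-- `l` is multiply aligned with `F`: at every point, in a null frame containing `l`, all components
`F_{a₀ … a_p}` of non-negative boost weight vanish. (Whether they do is independent of the choice
of the other frame vectors.) -/
def MultiplyAligned {k : ℕ} (g : LorentzMetric d M) (l : ∀ x : M, TangentSpace (𝓡 d) x)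
    (F : ∀ x : M, TangentSpace (𝓡 d) x [⋀^Fin k]→L[ℝ] ℝ) : Prop :=
  ∀ x : M, ∃ e : NullFrame g x (l x), ∀ a : Fin k → FrameIndex d,
    0 ≤ ∑ i, indexBoost (a i) → F x (fun i => e.vec (a i)) = 0

/-- `l` is geodesic at `x`: `∇_l l` is a multiple of `l` there. -/
def GeodesicAt (g : LorentzMetric d M) (l : ∀ x : M, TangentSpace (𝓡 d) x) (x : M) : Prop :=
  ∃ c : ℝ, nabla g l x (l x) = c • l x

/-- The optical matrix `ρ_{ij} = m_i^μ m_j^ν ∇_ν l_μ` of `l` at `x` in the null frame `e`. -/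
def opticalMatrix (g : LorentzMetric d M) (l : ∀ x : M, TangentSpace (𝓡 d) x) (x : M)
    (e : NullFrame g x (l x)) : Matrix (Fin (d - 2)) (Fin (d - 2)) ℝ :=
  Matrix.of fun i j => g.val x (e.m i) (nabla g l x (e.m j))

/-- The components `φ'_{k₁ … k_p} = F_{1 k₁ … k_p}` of boost weight `-1`. -/
def phiPrime {p : ℕ} {g : LorentzMetric d M} {x : M} {l : TangentSpace (𝓡 d) x}
    (e : NullFrame g x l) (F : TangentSpace (𝓡 d) x [⋀^Fin (p + 1)]→L[ℝ] ℝ)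
    (k : Fin p → Fin (d - 2)) : ℝ :=
  F (Fin.cons e.n (fun i => e.m (k i)) : Fin (p + 1) → TangentSpace (𝓡 d) x)

end Spacetime

/-- The symmetric part `ρ_{(ij)}` of a real matrix. -/
def symPart {n : ℕ} (A : Matrix (Fin n) (Fin n) ℝ) : Matrix (Fin n) (Fin n) ℝ :=
  (1 / 2 : ℝ) • (A + A.transpose)

/-- The antisymmetric part `ρ_{[ij]}` of a real matrix. -/
def antisymPart {n : ℕ} (A : Matrix (Fin n) (Fin n) ℝ) : Matrix (Fin n) (Fin n) ℝ :=
  (1 / 2 : ℝ) • (A - A.transpose)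

theorem symPart_isHermitian {n : ℕ} (A : Matrix (Fin n) (Fin n) ℝ) : (symPart A).IsHermitian := by
  ext i j
  simp [symPart, mul_add, add_comm]

end NullAlign

end

noncomputable section

namespace NullAlign

/-! ### Coordinate expressions in a chart: differentiability, and values at the centre. -/

section Charts

variable {d : ℕ} {M : Type*} [TopologicalSpace M] [ChartedSpace (Coord d) M]

/-! Multiple alignment means `F = ℓ♭ ∧ φ'`, equivalently `ι_ℓ F = 0` and `ℓ♭ ∧ F = 0` (`IsAligned`).
These identities involve no frame and hold at every point, so they can be differentiated without
extending `n` and `m_i` to fields. Write `B u = ∇_u ℓ`. Differentiation expresses `∇_u F` through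
`B` when one argument is `ℓ` or all arguments are orthogonal to `ℓ`. Together with the Maxwell
equations these relations form `IsAlignedJet`; what remains is linear algebra at one point.

Closedness and `ι_ℓ F = 0` give `L_ℓ F = 0`, which determines `∇_ℓ F` (`T_l`). The divergence with
one argument `ℓ` gives `F(Bℓ, …, n, …) = 0`, and then `∇_ℓ F` evaluated on `(Bℓ, X)` with `X`
spatial yields `g(Bℓ, Bℓ) φ'(X) = 0`. So `Bℓ` is null and orthogonal to `ℓ`, hence a multiple of `ℓ`
(`B_l`).

The divergence on spatial vectors reads `ρ φ'(X_1, …, X_p) = ∑_j φ'(…, (ρ + ρᵀ) X_j, …)`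
(`trace_mul`). In an orthonormal eigenbasis of the symmetric part, the right side multiplies each
component of `φ'` by twice the sum of the eigenvalues of its `p` distinct labels, so a non-zero
component selects eigenvalues with sum `ρ/2`; the trace gives the others (`exists_eigenvalues`). For
`p = 1` this is the eigenvector equation of `φ'`, and closedness on three spatial vectors says that
the wedge of `φ'` with the antisymmetric part of `ρ` vanishes, so `φ'` divides that part
(`two_form`). -/

theorem eventually_mem_extChartAt_target (x : M) :
    ∀ᶠ y in nhds (extChartAt (𝓡 d) x x), y ∈ (extChartAt (𝓡 d) x).target :=
  extChartAt_target_mem_nhds x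

theorem bilInChart_apply (g : ∀ x : M, TangentSpace (𝓡 d) x →L[ℝ] TangentSpace (𝓡 d) x →L[ℝ] ℝ)
    (x : M) (y u v : Coord d) : bilInChart g x y u v =
      g ((extChartAt (𝓡 d) x).symm y) (chartTangent x y u) (chartTangent x y v) := rfl

theorem formInChart_apply {k : ℕ} (F : ∀ x : M, TangentSpace (𝓡 d) x [⋀^Fin k]→L[ℝ] ℝ)
    (x : M) (y : Coord d) (v : Fin k → Coord d) : formInChart F x y v =
      F ((extChartAt (𝓡 d) x).symm y) (fun i => chartTangent x y (v i)) := rfl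

/-- The chart target is a neighbourhood of the centre, so agreement there is enough. This converts
smoothness of a bundle section, read in a trivialization, into differentiability of its coordinate
expression. -/
theorem differentiableAt_of_contMDiffAt_comp {E : Type*} [NormedAddCommGroup E] [NormedSpace ℝ E]
    {x : M} {f : M → E} {h : Coord d → E} (hf : ContMDiffAt (𝓡 d) 𝓘(ℝ, E) ∞ f x)
    (hh : ∀ y ∈ (extChartAt (𝓡 d) x).target, h y = f ((extChartAt (𝓡 d) x).symm y)) :
    DifferentiableAt ℝ h (extChartAt (𝓡 d) x x) := by
  have h2 := (contMDiffAt_iff.1 hf).2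
  rw [ModelWithCorners.range_eq_univ, contDiffWithinAt_univ] at h2
  refine (h2.differentiableAt (by simp)).congr_of_eventuallyEq ?_
  filter_upwards [eventually_mem_extChartAt_target x] with y hy
  rw [hh y hy]
  rfl

variable [IsManifold (𝓡 d) ∞ M]

theorem chartTangent_eq_symmL (x : M) {y : Coord d} (hy : y ∈ (extChartAt (𝓡 d) x).target) :
      chartTangent x y = (trivializationAt (Coord d) (TangentSpace (𝓡 d)) x).symmL ℝ
      ((extChartAt (𝓡 d) x).symm y) := by
  have hs : (extChartAt (𝓡 d) x).symm y ∈ (chartAt (Coord d) x).source := by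
    simpa using (extChartAt (𝓡 d) x).map_target hy
  have h := TangentBundle.symmL_trivializationAt (I := 𝓡 d) hs
  rw [ModelWithCorners.range_eq_univ, mfderivWithin_univ,
    (extChartAt (𝓡 d) x).right_inv hy] at h
  exact h.symm

theorem chartTangent_self (x : M) (v : Coord d) :
    chartTangent x (extChartAt (𝓡 d) x x) v = v := by
  have h := mfderivWithin_range_extChartAt_symm (I := 𝓡 d) (x := x)
  rw [ModelWithCorners.range_eq_univ, mfderivWithin_univ] at h
  unfold chartTangent
  rw [h]
  rfl

theorem chartTangent_vecInChart (Y : ∀ x : M, TangentSpace (𝓡 d) x) (x : M) {y : Coord d}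
    (hy : y ∈ (extChartAt (𝓡 d) x).target) :
    chartTangent x y (vecInChart Y x y) = Y ((extChartAt (𝓡 d) x).symm y) := by
  have h := mfderivWithin_extChartAt_symm_comp_mfderiv_extChartAt (I := 𝓡 d) (x := x) hy
  rw [ModelWithCorners.range_eq_univ, mfderivWithin_univ] at h
  exact congrArg (fun A => A (Y ((extChartAt (𝓡 d) x).symm y))) h

theorem differentiableAt_vecInChart {Y : ∀ x : M, TangentSpace (𝓡 d) x} (hY : SmoothVec Y)
    (x : M) : DifferentiableAt ℝ (vecInChart Y x) (extChartAt (𝓡 d) x x) := by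
  have h := (Bundle.contMDiffAt_section (x₀ := x)).1 (hY x)
  refine differentiableAt_of_contMDiffAt_comp h fun y hy => ?_
  have hs : (extChartAt (𝓡 d) x).symm y ∈ (chartAt (Coord d) x).source := by
    simpa using (extChartAt (𝓡 d) x).map_target hy
  have h2 := TangentBundle.continuousLinearMapAt_trivializationAt (I := 𝓡 d) hs
  have h3 := congrArg (fun A => A (Y ((extChartAt (𝓡 d) x).symm y))) h2
  rw [Bundle.Trivialization.continuousLinearMapAt_apply,
    Bundle.Trivialization.linearMapAt_apply, if_pos (by simpa using hs)] at h3
  exact h3.symm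

theorem differentiableAt_formInChart {k : ℕ}
    {F : ∀ x : M, TangentSpace (𝓡 d) x [⋀^Fin k]→L[ℝ] ℝ} (hF : SmoothForm F)
    (x : M) : DifferentiableAt ℝ (formInChart F x) (extChartAt (𝓡 d) x x) := by
  have h := (Bundle.contMDiffAt_totalSpace.1 (hF x)).2
  refine differentiableAt_of_contMDiffAt_comp h fun y hy => ?_
  rw [FiberBundle.trivializationAt_continuousAlternatingMap_apply]
  unfold formInChart ContinuousAlternatingMap.inCoordinates
  rw [chartTangent_eq_symmL x hy]
  ext v
  simp
  rfl

set_option synthInstance.maxHeartbeats 200000 in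
theorem differentiableAt_bilInChart
    {g : ∀ x : M, TangentSpace (𝓡 d) x →L[ℝ] TangentSpace (𝓡 d) x →L[ℝ] ℝ} (hg : SmoothBil g)
    (x : M) : DifferentiableAt ℝ (bilInChart g x) (extChartAt (𝓡 d) x x) := by
  have h := (Bundle.contMDiffAt_totalSpace.1 (hg x)).2
  refine differentiableAt_of_contMDiffAt_comp h fun y hy => ?_
  have hs : (extChartAt (𝓡 d) x).symm y ∈ (chartAt (Coord d) x).source := by
    simpa using (extChartAt (𝓡 d) x).map_target hy
  rw [hom_trivializationAt_apply]
  ext v w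
  rw [bilInChart_apply, chartTangent_eq_symmL x hy]
  refine Eq.trans ?_ (inCoordinates_apply_eq₂ (by simpa using hs) (by simpa using hs)
    (by simp)).symm
  refine Eq.trans ?_ (congrFun (Bundle.Trivialization.coe_linearMapAt_of_mem _
    (Set.mem_univ _)) _).symm
  rw [Bundle.Trivialization.symmL_apply _ (by simpa using hs),
    Bundle.Trivialization.symmL_apply _ (by simpa using hs)]
  rfl

theorem bilInChart_self (g : ∀ x : M, TangentSpace (𝓡 d) x →L[ℝ] TangentSpace (𝓡 d) x →L[ℝ] ℝ)
    (x : M) (u v : Coord d) : bilInChart g x (extChartAt (𝓡 d) x x) u v = g x u v := by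
  rw [bilInChart_apply, chartTangent_self, chartTangent_self]
  have h : (extChartAt (𝓡 d) x).symm (extChartAt (𝓡 d) x x) = x := extChartAt_to_inv x
  exact congrArg (fun z : M =>
    (g z : Coord d →L[ℝ] Coord d →L[ℝ] ℝ) u v) h

theorem formInChart_self {k : ℕ} (F : ∀ x : M, TangentSpace (𝓡 d) x [⋀^Fin k]→L[ℝ] ℝ)
    (x : M) (v : Fin k → Coord d) : formInChart F x (extChartAt (𝓡 d) x x) v = F x v := by
  rw [formInChart_apply]
  simp only [chartTangent_self]
  have h : (extChartAt (𝓡 d) x).symm (extChartAt (𝓡 d) x x) = x := extChartAt_to_inv x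
  exact congrArg (fun z : M => (F z : Coord d [⋀^Fin k]→L[ℝ] ℝ) v) h

theorem vecInChart_self (Y : ∀ x : M, TangentSpace (𝓡 d) x) (x : M) :
    vecInChart Y x (extChartAt (𝓡 d) x x) = Y x := by
  have h := chartTangent_vecInChart Y x (mem_extChartAt_target (I := 𝓡 d) x)
  rw [chartTangent_self] at h
  rw [h]
  have h : (extChartAt (𝓡 d) x).symm (extChartAt (𝓡 d) x x) = x := extChartAt_to_inv x
  exact congrArg (fun z : M => (Y z : Coord d)) h

end Charts

/-! ### Null frames and aligned forms in a single vector space -/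

section Frame

variable {V ι : Type*} [NormedAddCommGroup V] [NormedSpace ℝ V]

/-- A tuple of frame indices in which the index of `n` does not occur has non-negative boost
weight. -/
theorem sum_boost_nonneg {k : ℕ} {a : Fin k → Fin 2 ⊕ ι} (b : Fin 2 ⊕ ι → ℤ)
    (hb0 : b (.inl 0) = 1) (hbr : ∀ i, b (.inr i) = 0) (h1 : ∀ i, a i ≠ .inl 1) :
    0 ≤ ∑ i, b (a i) := by
  refine Finset.sum_nonneg fun i _ => ?_
  rcases h : a i with c | j
  · fin_cases c
    · simp [hb0]
    · exact absurd h (h1 i)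
  · simp [hbr]

/-- An injective tuple of frame indices in which the index of `l` occurs has non-negative boost
weight. -/
theorem sum_boost_nonneg_of_injective {k : ℕ} {a : Fin k → Fin 2 ⊕ ι} (b : Fin 2 ⊕ ι → ℤ)
    (hb0 : b (.inl 0) = 1) (hb1 : b (.inl 1) = -1) (hbr : ∀ i, b (.inr i) = 0)
    (ha : Function.Injective a) {i : Fin k} (hi : a i = .inl 0) :
    0 ≤ ∑ i, b (a i) := by
  by_cases h1 : ∃ j, a j = .inl 1
  · obtain ⟨j, hj⟩ := h1
    have hij : j ≠ i := by
      rintro rfl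
      simp [hi] at hj
    rw [← Finset.add_sum_erase _ _ (Finset.mem_univ i),
      ← Finset.add_sum_erase _ _ (Finset.mem_erase.2 ⟨hij, Finset.mem_univ j⟩), hi, hj, hb0, hb1,
      Finset.sum_eq_zero]
    · simp
    · intro q hq
      simp only [Finset.mem_erase, Finset.mem_univ, and_true] at hq
      rcases h : a q with c | r
      · fin_cases c
        · exact absurd (ha (h.trans hi.symm)) hq.2
        · exact absurd (ha (h.trans hj.symm)) hq.1
      · exact hbr r
  · push Not at h1
    exact sum_boost_nonneg b hb0 hbr h1

variable [DecidableEq ι]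

/-- The vectors `l`, `n`, `m i` have the scalar products of a null frame. -/
structure IsNullFrame (g : V →L[ℝ] V →L[ℝ] ℝ) (l n : V) (m : ι → V) : Prop where
  symm : ∀ u v, g u v = g v u
  l_l : g l l = 0
  n_n : g n n = 0
  l_n : g l n = 1
  l_m : ∀ i, g l (m i) = 0
  n_m : ∀ i, g n (m i) = 0
  m_m : ∀ i j, g (m i) (m j) = if i = j then 1 else 0

/-- The family `l`, `n`, `m i`. -/
def frameVec (l n : V) (m : ι → V) : Fin 2 ⊕ ι → V := Sum.elim ![l, n] m

namespace IsNullFrame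

variable {g : V →L[ℝ] V →L[ℝ] ℝ} {l n : V} {m : ι → V}

theorem linearIndependent [Fintype ι] (h : IsNullFrame g l n m) :
    LinearIndependent ℝ (frameVec l n m) := by
  rw [Fintype.linearIndependent_iff]
  intro c hc
  simp only [frameVec, Fintype.sum_sum_type, Fin.sum_univ_two, Sum.elim_inl, Sum.elim_inr,
    Matrix.cons_val_zero, Matrix.cons_val_one] at hc
  have key : ∀ w, c (.inl 0) * g w l + c (.inl 1) * g w n +
      ∑ i, c (.inr i) * g w (m i) = 0 := fun w => by
    have := congrArg (g w) hc
    simpa [map_sum] using this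
  have h0 := key n
  have h1 := key l
  simp only [h.symm n l, h.l_n, h.n_n, h.n_m, h.l_l, h.l_m, mul_zero, mul_one,
    Finset.sum_const_zero, add_zero, zero_add] at h0 h1
  rintro (a | i)
  · fin_cases a
    · exact h0
    · exact h1
  · have h2 := key (m i)
    simpa [h.symm (m i) l, h.symm (m i) n, h.l_m, h.n_m, h.m_m] using h2

/-- The basis given by a null frame. -/
def basis [Fintype ι] (h : IsNullFrame g l n m) (hd : 2 + Fintype.card ι = Module.finrank ℝ V) :
    Module.Basis (Fin 2 ⊕ ι) ℝ V :=
  haveI : Nonempty (Fin 2 ⊕ ι) := ⟨.inl 0⟩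
  basisOfLinearIndependentOfCardEqFinrank h.linearIndependent (by simpa using hd)

@[simp]
theorem coe_basis [Fintype ι] (h : IsNullFrame g l n m)
    (hd : 2 + Fintype.card ι = Module.finrank ℝ V) : ⇑(h.basis hd) = frameVec l n m := by
  simp [basis]

/-- Completeness relation of a null frame. -/
theorem sum_eq [Fintype ι] (h : IsNullFrame g l n m)
    (hd : 2 + Fintype.card ι = Module.finrank ℝ V) (v : V) :
    g n v • l + g l v • n + ∑ i, g (m i) v • m i = v := by
  have key : (g n).smulRight l + (g l).smulRight n + ∑ i, (g (m i)).smulRight (m i) =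
      ContinuousLinearMap.id ℝ V := by
    apply ContinuousLinearMap.coe_injective
    refine (h.basis hd).ext fun a => ?_
    rcases a with a | i
    · fin_cases a <;>
        simp [frameVec, h.l_l, h.n_n, h.symm n l, h.symm (m _) l, h.symm (m _) n, h.l_n, h.l_m,
          h.n_m]
    · simp [frameVec, h.l_m, h.n_m, h.m_m]
  simpa using congrArg (fun A : V →L[ℝ] V => A v) key

/-- A null vector orthogonal to `l` is a multiple of `l`. -/
theorem eq_smul_of_null [Fintype ι] (h : IsNullFrame g l n m)
    (hd : 2 + Fintype.card ι = Module.finrank ℝ V) {v : V} (hl : g l v = 0) (hv : g v v = 0) :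
    v = g n v • l := by
  have e := h.sum_eq hd v
  rw [hl, zero_smul, add_zero] at e
  -- As `v` has no `n`-component, its norm is the sum of squares of its spatial components.
  have h2 : g v v = ∑ i, g (m i) v * g (m i) v := by
    nth_rw 1 [← e]
    simp [hl]
  rw [hv, eq_comm, Finset.sum_eq_zero_iff_of_nonneg (fun i _ => mul_self_nonneg _)] at h2
  rw [Finset.sum_eq_zero fun i hi => by rw [mul_self_eq_zero.1 (h2 i hi), zero_smul], add_zero] at e
  exact e.symm

end IsNullFrame

/-- `F = l ∧ φ`: the contraction of `F` with `l` and the exterior product of `F` with the covector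
dual to `l` vanish. The second condition is contracted with an auxiliary vector `w`. -/
structure IsAligned {p : ℕ} (g : V →L[ℝ] V →L[ℝ] ℝ) (l : V) (F : V [⋀^Fin (p + 1)]→L[ℝ] ℝ) :
    Prop where
  contract : ∀ v i, v i = l → F v = 0
  wedge : ∀ (w : V) (v : Fin (p + 1) → V),
    g l w * F v = ∑ i, g l (v i) * F (Function.update v i w)

theorem map_cons_succAbove {p : ℕ} (F : V [⋀^Fin (p + 1)]→L[ℝ] ℝ) (v : Fin (p + 1) → V)
    (i : Fin (p + 1)) (w : V) :
    F (Fin.cons w (fun j => v (i.succAbove j)) : Fin (p + 1) → V) =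
      (-1) ^ (i : ℕ) * F (Function.update v i w) := by
  have h := F.neg_one_pow_smul_map_insertNth i w (i.removeNth v)
  rw [Fin.insertNth_removeNth, zsmul_eq_mul, Int.cast_pow, Int.cast_neg, Int.cast_one] at h
  exact h.symm

/-- An alternating form is determined by injective tuples of basis vectors. With `ℓ` among the
indices, `n` can occur only once and the boost weight is non-negative. In a term of `ℓ♭ ∧ F`, the
factor `g ℓ (e_k)` vanishes unless `e_k = n`, and then no `n` is left for `F`. -/
theorem IsNullFrame.isAligned [Fintype ι] {p : ℕ} {g : V →L[ℝ] V →L[ℝ] ℝ} {l n : V} {m : ι → V}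
    (h : IsNullFrame g l n m) (hd : 2 + Fintype.card ι = Module.finrank ℝ V)
    {F : V [⋀^Fin (p + 1)]→L[ℝ] ℝ} (b : Fin 2 ⊕ ι → ℤ)
    (hb0 : b (.inl 0) = 1) (hb1 : b (.inl 1) = -1) (hbr : ∀ i, b (.inr i) = 0)
    (hF : ∀ a : Fin (p + 1) → Fin 2 ⊕ ι, 0 ≤ ∑ i, b (a i) →
      F (fun i => frameVec l n m (a i)) = 0) :
    IsAligned g l F := by
  constructor
  · intro v i hi
    have h0 : ∀ X : Fin p → V, F (Fin.cons l X : Fin (p + 1) → V) = 0 := by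
      have : F.toAlternatingMap.curryLeft l = 0 := by
        refine (h.basis hd).ext_alternating fun a ha => ?_
        have e : (Fin.cons l (fun j => frameVec l n m (a j)) : Fin (p + 1) → V) =
            fun i => frameVec l n m ((Fin.cons (.inl 0) a : Fin (p + 1) → Fin 2 ⊕ ι) i) := by
          funext i
          refine Fin.cases ?_ (fun j => ?_) i
          · simp [frameVec]
          · simp
        simp only [coe_basis, AlternatingMap.zero_apply]
        change F (Fin.cons l (fun j => frameVec l n m (a j)) : Fin (p + 1) → V) = 0
        rw [e]
        by_cases hinj : Function.Injective (Fin.cons (.inl 0) a : Fin (p + 1) → Fin 2 ⊕ ι)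
        · exact hF _ (sum_boost_nonneg_of_injective b hb0 hb1 hbr hinj (i := 0) rfl)
        · simp only [Function.Injective, not_forall] at hinj
          obtain ⟨i, j, hij, hne⟩ := hinj
          exact F.map_eq_zero_of_eq _ (by simp only [hij]) hne
      intro X
      exact congrArg (fun A : V [⋀^Fin p]→ₗ[ℝ] ℝ => A X) this
    have h1 := map_cons_succAbove F v i l
    rw [h0, ← hi, Function.update_eq_self] at h1
    simpa using h1
  -- This alternatization of `g l ⊗ F` is the exterior product `ℓ♭ ∧ F`; the wedge condition is its
  -- expansion on `(w, v)`.
  · have key : (ContinuousAlternatingMap.alternatizeUncurryFin ((g l).smulRight F)).toAlternatingMap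
        = 0 := by
      refine (h.basis hd).ext_alternating fun a ha => ?_
      simp only [coe_basis, AlternatingMap.zero_apply]
      change ContinuousAlternatingMap.alternatizeUncurryFin ((g l).smulRight F)
        (fun i => frameVec l n m (a i)) = 0
      rw [ContinuousAlternatingMap.alternatizeUncurryFin_apply]
      refine Finset.sum_eq_zero fun k _ => ?_
      by_cases hk : a k = .inl 1
      · have : F (k.removeNth fun i => frameVec l n m (a i)) = 0 :=
          hF (fun j => a (k.succAbove j)) (sum_boost_nonneg b hb0 hbr fun j hj =>
            Fin.succAbove_ne k j (ha (hj.trans hk.symm)))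
        simp [this]
      · have : g l (frameVec l n m (a k)) = 0 := by
          rcases hc : a k with c | j
          · fin_cases c
            · simpa [frameVec] using h.l_l
            · exact absurd hc hk
          · simpa [frameVec] using h.l_m j
        simp [this]
    intro w v
    have h1 := congrArg (fun A : V [⋀^Fin (p + 2)]→ₗ[ℝ] ℝ => A (Fin.cons w v)) key
    change ContinuousAlternatingMap.alternatizeUncurryFin ((g l).smulRight F) (Fin.cons w v) = 0
      at h1
    rw [ContinuousAlternatingMap.alternatizeUncurryFin_apply, Fin.sum_univ_succ] at h1
    have h2 : ∀ i : Fin (p + 1), (i.succ.removeNth (Fin.cons w v : Fin (p + 2) → V)) =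
        Fin.cons w (fun j => v (i.succAbove j)) := by
      intro i
      funext j
      refine Fin.cases ?_ (fun j => ?_) j <;> simp [Fin.removeNth]
    have h3 : (Fin.removeNth 0 (Fin.cons w v : Fin (p + 2) → V)) = v := by
      funext j
      simp [Fin.removeNth]
    simp only [h2, h3, ContinuousLinearMap.smulRight_apply, ContinuousAlternatingMap.smul_apply,
      Fin.cons_zero, Fin.cons_succ, map_cons_succAbove, zsmul_eq_mul, smul_eq_mul, Fin.val_succ,
      pow_succ, Fin.val_zero, pow_zero, one_mul, Int.cast_pow, Int.cast_neg, Int.cast_one, Int.cast_mul] at h1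
    rw [eq_comm, ← sub_eq_zero, ← neg_eq_zero, ← h1, neg_sub, sub_eq_add_neg, ← Finset.sum_neg_distrib]
    refine congrArg₂ _ rfl (Finset.sum_congr rfl fun i _ => ?_)
    have : ((-1 : ℝ) ^ (i : ℕ)) * (-1) ^ (i : ℕ) = 1 := by
      rw [← mul_pow]; simp
    linear_combination (g l (v i) * F (Function.update v i w)) * this

namespace IsAligned

variable {p : ℕ} {g : V →L[ℝ] V →L[ℝ] ℝ} {l n : V} {F : V [⋀^Fin (p + 1)]→L[ℝ] ℝ}

theorem map_eq_zero_of_orthogonal (hF : IsAligned g l F) (hn : g l n = 1) {v : Fin (p + 1) → V}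
    (hv : ∀ i, g l (v i) = 0) : F v = 0 := by
  have := hF.wedge n v
  simpa [hn, hv] using this

/-- A nonvanishing aligned form has a nonvanishing component of boost weight `-1`. -/
theorem exists_ne_zero [Fintype ι] {m : ι → V} (hF : IsAligned g l F)
    (h : IsNullFrame g l n m) (hd : 2 + Fintype.card ι = Module.finrank ℝ V) (hne : F ≠ 0) :
    ∃ K : Fin p → ι, Function.Injective K ∧
      F (Fin.cons n (fun j => m (K j)) : Fin (p + 1) → V) ≠ 0 := by
  by_contra! hc
  have hc' : ∀ K : Fin p → ι, F (Fin.cons n (fun j => m (K j)) : Fin (p + 1) → V) = 0 := by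
    intro K
    by_cases hK : Function.Injective K
    · exact hc K hK
    · simp only [Function.Injective, not_forall] at hK
      obtain ⟨i, j, hij, hne⟩ := hK
      exact F.map_eq_zero_of_eq (i := i.succ) (j := j.succ) _ (by simp [hij])
        (by simpa using hne)
  apply hne
  apply ContinuousAlternatingMap.toAlternatingMap_injective
  refine (h.basis hd).ext_alternating fun a ha => ?_
  simp only [IsNullFrame.coe_basis]
  change F (fun i => frameVec l n m (a i)) = 0
  -- Components with an index `ℓ` vanish by contraction, and those with neither `ℓ` nor `n` by
  -- orthogonality. In the others `n` occurs exactly once and can be moved to the front.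
  by_cases h0 : ∃ i, a i = .inl 0
  · obtain ⟨i, hi⟩ := h0
    exact hF.contract _ i (by simp [hi, frameVec])
  by_cases h1 : ∃ i, a i = .inl 1
  · obtain ⟨i, hi⟩ := h1
    have hr : ∀ j, ∃ k, a (i.succAbove j) = .inr k := by
      intro j
      rcases hj : a (i.succAbove j) with c | k
      · fin_cases c
        · exact absurd ⟨_, hj⟩ h0
        · exact absurd (ha (hj.trans hi.symm)) (Fin.succAbove_ne i j)
      · exact ⟨k, rfl⟩
    choose K hK using hr
    have e := map_cons_succAbove F (fun i => frameVec l n m (a i)) i n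
    have e1 : Function.update (fun i => frameVec l n m (a i)) i n =
        fun i => frameVec l n m (a i) := by
      rw [Function.update_eq_self_iff]
      simp [hi, frameVec]
    simp only [hK] at e
    rw [e1] at e
    have e2 := hc' K
    simp only [frameVec, Sum.elim_inr] at e e2 ⊢
    rw [e2] at e
    simpa using e.symm
  · push Not at h0 h1
    refine hF.map_eq_zero_of_orthogonal h.l_n fun i => ?_
    rcases hi : a i with c | k
    · fin_cases c
      · exact absurd hi (h0 i)
      · exact absurd hi (h1 i)
    · simpa [frameVec] using h.l_m k

end IsAligned

end Frame

/-! ### The first-order equations of an aligned Maxwell field at a point -/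

section Jet

variable {V ι : Type*} [NormedAddCommGroup V] [NormedSpace ℝ V] [Fintype ι] {p : ℕ}

theorem map_update_sum_smul {k : ℕ} (F : V [⋀^Fin k]→L[ℝ] ℝ) (v : Fin k → V) (i : Fin k)
    (c : ι → ℝ) (x : ι → V) : F (Function.update v i (∑ j, c j • x j)) =
      ∑ j, c j * F (Function.update v i (x j)) := by
  change F.1.toContinuousLinearMap v i (∑ j, c j • x j) = _
  simp only [map_sum, map_smul, smul_eq_mul]
  rfl

variable [DecidableEq ι]

/-- The equations satisfied at a point by `B u = ∇_u l` and `T u = ∇_u F` for a Maxwell field `F`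
with which the null vector field `l` is multiply aligned. -/
structure IsAlignedJet (g : V →L[ℝ] V →L[ℝ] ℝ) (l n : V) (m : ι → V)
    (F : V [⋀^Fin (p + 1)]→L[ℝ] ℝ) (B : V →ₗ[ℝ] V) (T : V → (Fin (p + 1) → V) → ℝ) : Prop where
  frame : IsNullFrame g l n m
  finrank : 2 + Fintype.card ι = Module.finrank ℝ V
  aligned : IsAligned g l F
  inner_B : ∀ u, g l (B u) = 0
  T_contract : ∀ u v i, v i = l → T u v = -F (Function.update v i (B u))
  T_orthogonal : ∀ u v, (∀ i, g l (v i) = 0) →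
    T u v = ∑ i, g (B u) (v i) * F (Function.update v i n)
  div : ∀ X : Fin p → V, T l (Fin.cons n X) + T n (Fin.cons l X) +
    ∑ i, T (m i) (Fin.cons (m i) X) = 0
  curl : ∀ w : Fin (p + 2) → V,
    ∑ i : Fin (p + 2), (-1 : ℝ) ^ (i : ℕ) * T (w i) (fun j => w (i.succAbove j)) = 0

theorem map_cons_update_swap (F : V [⋀^Fin (p + 1)]→L[ℝ] ℝ) (X : Fin p → V) (i : Fin p) (a b : V) :
    F (Fin.cons a (Function.update X i b) : Fin (p + 1) → V) =
      -F (Fin.cons b (Function.update X i a) : Fin (p + 1) → V) := by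
  have h := F.map_swap (Fin.cons b (Function.update X i a) : Fin (p + 1) → V)
    (i := 0) (j := i.succ) (Fin.succ_ne_zero i).symm
  change F (_ ∘ _) = -F _ at h
  rw [← h]
  congr 1
  funext j
  refine Fin.cases ?_ (fun j => ?_) j
  · simp [-Fin.cons_update]
  · by_cases hj : j = i
    · subst hj; simp [-Fin.cons_update]
    · have : Equiv.swap (0 : Fin (p + 1)) i.succ j.succ = j.succ :=
        Equiv.swap_apply_of_ne_of_ne (Fin.succ_ne_zero j) (by simpa using hj)
      simp [-Fin.cons_update, this, Function.update_of_ne hj]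

theorem cons_orthogonal {g : V →L[ℝ] V →L[ℝ] ℝ} {l a : V} {X : Fin p → V} (ha : g l a = 0)
    (hX : ∀ i, g l (X i) = 0) (i : Fin (p + 1)) :
    g l ((Fin.cons a X : Fin (p + 1) → V) i) = 0 := by
  refine Fin.cases ?_ (fun j => ?_) i
  · simpa using ha
  · simpa using hX j

theorem update_orthogonal {k : ℕ} {g : V →L[ℝ] V →L[ℝ] ℝ} {l a : V} {X : Fin k → V} (ha : g l a = 0)
    (hX : ∀ i, g l (X i) = 0) (j i : Fin k) : g l (Function.update X j a i) = 0 := by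
  by_cases h : i = j
  · subst h; simpa using ha
  · simpa [Function.update_of_ne h] using hX i

namespace IsAlignedJet

variable {g : V →L[ℝ] V →L[ℝ] ℝ} {l n : V} {m : ι → V} {F : V [⋀^Fin (p + 1)]→L[ℝ] ℝ}
  {B : V →ₗ[ℝ] V} {T : V → (Fin (p + 1) → V) → ℝ}

theorem map_orthogonal (h : IsAlignedJet g l n m F B T) {v : Fin (p + 1) → V}
    (hv : ∀ i, g l (v i) = 0) : F v = 0 :=
  h.aligned.map_eq_zero_of_orthogonal h.frame.l_n hv

/-- The Lie derivative of `F` along `l` vanishes. -/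
theorem T_l (h : IsAlignedJet g l n m F B T) (w : Fin (p + 1) → V) :
    T l w = -∑ i, F (Function.update w i (B (w i))) := by
  have hc := h.curl (Fin.cons l w)
  rw [Fin.sum_univ_succ] at hc
  -- In all terms of the curl but the first, `ℓ` is an argument of `F`, so `T_contract` evaluates
  -- them.
  have h2 : ∀ i : Fin (p + 1), T (w i) (fun j => (Fin.cons l w : Fin (p + 2) → V)
      (i.succ.succAbove j)) = -((-1) ^ (i : ℕ) * F (Function.update w i (B (w i)))) := by
    intro i
    rw [h.T_contract _ _ 0 (by simp), ← map_cons_succAbove]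
    congr 2
    funext j
    refine Fin.cases ?_ (fun j => ?_) j <;> simp
  simp only [Fin.cons_zero, Fin.cons_succ, h2, Fin.val_zero, pow_zero, one_mul, Fin.val_succ,
    pow_succ, Fin.succAbove_zero] at hc
  rw [eq_neg_iff_add_eq_zero, ← hc]
  refine congrArg₂ _ rfl (Finset.sum_congr rfl fun i _ => ?_)
  have : ((-1 : ℝ) ^ (i : ℕ)) * (-1) ^ (i : ℕ) = 1 := by
    rw [← mul_pow]; simp
  linear_combination -F (Function.update w i (B (w i))) * this

theorem T_l_orthogonal (h : IsAlignedJet g l n m F B T) {w : Fin (p + 1) → V}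
    (hw : ∀ i, g l (w i) = 0) : T l w = 0 := by
  rw [h.T_l, Finset.sum_eq_zero fun i _ => h.map_orthogonal
    (update_orthogonal (h.inner_B _) hw i), neg_zero]

/-- This is the divergence equation with `ℓ` in slot `i`. Its `m_j` terms evaluate `F` on vectors
orthogonal to `ℓ`, and its `T n` term still contains `ℓ`, so only the `T l` term survives. -/
theorem map_B_l (h : IsAlignedJet g l n m F B T) {X : Fin p → V} (hX : ∀ i, g l (X i) = 0)
    (i : Fin p) : F (Fin.cons (B l) (Function.update X i n) : Fin (p + 1) → V) = 0 := by
  have hd := h.div (Function.update X i l)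
  rw [h.T_contract l _ i.succ (by simp), h.T_contract n _ 0 (by simp), Finset.sum_eq_zero] at hd
  · rw [Fin.update_cons_zero, h.aligned.contract (Fin.cons (B n) (Function.update X i l)) i.succ
      (by simp), ← Fin.cons_update, Function.update_idem, map_cons_update_swap] at hd
    simpa using hd
  · intro j _
    rw [h.T_contract _ _ i.succ (by simp), ← Fin.cons_update, Function.update_idem,
      h.map_orthogonal (cons_orthogonal (h.frame.l_m j) (update_orthogonal (h.inner_B _) hX i)),
      neg_zero]

/-- `l` is geodesic. -/
theorem B_l (h : IsAlignedJet g l n m F B T) (hF : F ≠ 0) : B l = g n (B l) • l := by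
  obtain ⟨K, -, hK⟩ := h.aligned.exists_ne_zero h.frame h.finrank hF
  refine h.frame.eq_smul_of_null h.finrank (h.inner_B l) ?_
  set X : Fin p → V := fun j => m (K j)
  have hX : ∀ i, g l (X i) = 0 := fun i => h.frame.l_m _
  have hv := cons_orthogonal (h.inner_B l) hX
  -- Here `∇_ℓ F` vanishes, and `map_B_l` removes every term but `g(Bℓ, Bℓ) F(n, X)`.
  have h1 := h.T_orthogonal l (Fin.cons (B l) X) hv
  rw [h.T_l_orthogonal hv, Fin.sum_univ_succ, Finset.sum_eq_zero (s := Finset.univ)] at h1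
  · rw [Fin.update_cons_zero, Fin.cons_zero, add_zero, eq_comm, mul_eq_zero] at h1
    exact h1.resolve_right hK
  · intro i _
    rw [← Fin.cons_update, h.map_B_l hX, mul_zero]

/-- In the divergence, `T l` contributes `B` acting on each slot, by Lie transport, while the `m_i`
terms contribute the trace and the transpose of `B`. Hence `φ'` is an eigenvector of the derivation
induced by `B + Bᵀ`. -/
theorem trace_mul (h : IsAlignedJet g l n m F B T) {X : Fin p → V} (hX : ∀ i, g l (X i) = 0) :
    (∑ i, g (m i) (B (m i))) * F (Fin.cons n X : Fin (p + 1) → V) =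
      ∑ j, F (Fin.cons n (Function.update X j
        (B (X j) + ∑ i, g (X j) (B (m i)) • m i)) : Fin (p + 1) → V) := by
  have hd := h.div X
  have h1 : T n (Fin.cons l X) = 0 := by
    rw [h.T_contract n _ 0 (by simp), Fin.update_cons_zero,
      h.map_orthogonal (cons_orthogonal (h.inner_B n) hX), neg_zero]
  have h2 : T l (Fin.cons n X) =
      -∑ j, F (Fin.cons n (Function.update X j (B (X j))) : Fin (p + 1) → V) := by
    rw [h.T_l, Fin.sum_univ_succ, Fin.update_cons_zero, Fin.cons_zero,
      h.map_orthogonal (cons_orthogonal (h.inner_B n) hX), zero_add]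
    simp only [← Fin.cons_update, Fin.cons_succ]
  have h3 : ∀ i, T (m i) (Fin.cons (m i) X) =
      g (m i) (B (m i)) * F (Fin.cons n X : Fin (p + 1) → V) -
      ∑ j, g (X j) (B (m i)) * F (Fin.cons n (Function.update X j (m i)) : Fin (p + 1) → V) := by
    intro i
    rw [h.T_orthogonal _ _ (cons_orthogonal (h.frame.l_m i) hX), Fin.sum_univ_succ,
      Fin.update_cons_zero, Fin.cons_zero, h.frame.symm, sub_eq_add_neg, ← Finset.sum_neg_distrib]
    refine congrArg₂ _ rfl (Finset.sum_congr rfl fun j _ => ?_)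
    rw [Fin.cons_succ, ← Fin.cons_update, map_cons_update_swap, h.frame.symm, mul_neg]
  have h4 : ∀ j, F (Fin.cons n (Function.update X j
        (B (X j) + ∑ i, g (X j) (B (m i)) • m i)) : Fin (p + 1) → V) =
      F (Fin.cons n (Function.update X j (B (X j))) : Fin (p + 1) → V) +
      ∑ i, g (X j) (B (m i)) * F (Fin.cons n (Function.update X j (m i)) : Fin (p + 1) → V) := by
    intro j
    simp only [Fin.cons_update, F.map_update_add, map_update_sum_smul]
  simp only [h1, h2, h3, add_zero, Finset.sum_sub_distrib, ← Finset.sum_mul] at hd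
  simp only [h4, Finset.sum_add_distrib]
  rw [Finset.sum_comm (s := Finset.univ (α := Fin p))]
  linear_combination hd

/-- If the vectors `X j` are orthogonal to `l` and, modulo `l`, eigenvectors of twice the symmetric
part of `B`, then the sum of their eigenvalues is half the trace of `B`. -/
theorem sum_eq_trace (h : IsAlignedJet g l n m F B T) {X : Fin p → V} (hX : ∀ i, g l (X i) = 0)
    {c b : Fin p → ℝ}
    (hc : ∀ j, B (X j) + ∑ i, g (X j) (B (m i)) • m i = (2 * c j) • X j + b j • l)
    (hF : F (Fin.cons n X : Fin (p + 1) → V) ≠ 0) :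
    ∑ j, c j = (∑ i, g (m i) (B (m i))) / 2 := by
  have h1 := h.trace_mul hX
  have h2 : ∀ j, F (Fin.cons n (Function.update X j
        (B (X j) + ∑ i, g (X j) (B (m i)) • m i)) : Fin (p + 1) → V) =
      2 * c j * F (Fin.cons n X : Fin (p + 1) → V) := by
    intro j
    rw [hc, Fin.cons_update, F.map_update_add, F.map_update_smul, F.map_update_smul,
      h.aligned.contract (Function.update _ _ l) j.succ (by simp), smul_zero, add_zero,
      ← Fin.cons_update, Function.update_eq_self, smul_eq_mul]
  simp only [h2, ← Finset.sum_mul, ← Finset.mul_sum] at h1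
  linarith [mul_right_cancel₀ hF h1]

end IsAlignedJet

/-! ### Two-forms: the eigenvector `φ'` and the antisymmetric part. -/

section TwoForm

variable {g : V →L[ℝ] V →L[ℝ] ℝ} {l n : V} {m : ι → V} {F : V [⋀^Fin 2]→L[ℝ] ℝ}
  {B : V →ₗ[ℝ] V} {T : V → (Fin 2 → V) → ℝ}

theorem IsAlignedJet.T_pair (h : IsAlignedJet (p := 1) g l n m F B T) (u : V) {a b : V}
    (ha : g l a = 0) (hb : g l b = 0) :
    T u ![a, b] = g a (B u) * F ![n, b] - g b (B u) * F ![n, a] := by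
  rw [h.T_orthogonal u ![a, b] (by intro i; fin_cases i <;> simpa), Fin.sum_univ_two]
  have h1 : Function.update ![a, b] 0 n = ![n, b] := by
    funext i; fin_cases i <;> simp
  have h2 : Function.update ![a, b] 1 n = ![a, n] := by
    funext i; fin_cases i <;> simp
  have h3 : F ![a, n] = -F ![n, a] := by
    have := F.map_swap ![n, a] (i := 0) (j := 1) (by simp)
    change F (_ ∘ _) = -F _ at this
    rw [← this]
    congr 1
    funext i; fin_cases i <;> simp
  rw [h1, h2, h3, h.frame.symm, h.frame.symm (B u)]
  simp
  ring

/-- Closedness on three vectors orthogonal to `ℓ`: the wedge of `φ'` with the antisymmetric part of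
`B` vanishes. -/
theorem IsAlignedJet.cyclic (h : IsAlignedJet (p := 1) g l n m F B T) {a b c : V}
    (ha : g l a = 0) (hb : g l b = 0) (hc : g l c = 0) :
    (g b (B a) - g a (B b)) * F ![n, c] + (g a (B c) - g c (B a)) * F ![n, b] +
      (g c (B b) - g b (B c)) * F ![n, a] = 0 := by
  have hw := h.curl ![a, b, c]
  have h0 : (fun j => ![a, b, c] ((0 : Fin 3).succAbove j)) = ![b, c] := by
    funext i; fin_cases i <;> rfl
  have h1 : (fun j => ![a, b, c] ((1 : Fin 3).succAbove j)) = ![a, c] := by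
    funext i; fin_cases i <;> rfl
  have h2 : (fun j => ![a, b, c] ((2 : Fin 3).succAbove j)) = ![a, b] := by
    funext i; fin_cases i <;> rfl
  rw [Fin.sum_univ_three, h0, h1, h2, h.T_pair _ hb hc, h.T_pair _ ha hc, h.T_pair _ ha hb] at hw
  simp at hw
  linear_combination hw

/-- The components `F(n, m_i)`. -/
theorem IsAlignedJet.two_form (h : IsAlignedJet (p := 1) g l n m F B T) (hF : F ≠ 0) :
    (fun i => F ![n, m i]) ≠ 0 ∧
    (∀ k, ∑ i, (g (m k) (B (m i)) + g (m i) (B (m k))) * F ![n, m i] =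
      (∑ i, g (m i) (B (m i))) * F ![n, m k]) ∧
    ∃ w : ι → ℝ, ∀ i j, g (m i) (B (m j)) - g (m j) (B (m i)) =
      F ![n, m i] * w j - F ![n, m j] * w i := by
  have hne : (fun i => F ![n, m i]) ≠ 0 := by
    obtain ⟨K, -, hK⟩ := h.aligned.exists_ne_zero h.frame h.finrank hF
    intro h0
    apply hK
    refine Eq.trans (congrArg F ?_) (congrFun h0 (K 0))
    funext i; fin_cases i <;> simp
  have hcons : ∀ X : Fin 1 → V, (Fin.cons n X : Fin 2 → V) = ![n, X 0] := by
    intro X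
    funext i; fin_cases i <;> simp
  refine ⟨hne, fun k => ?_, ?_⟩
  · have h1 := h.trace_mul (X := fun _ => m k) fun _ => h.frame.l_m k
    have h2 : B (m k) = g n (B (m k)) • l + ∑ i, g (m i) (B (m k)) • m i := by
      have := h.frame.sum_eq h.finrank (B (m k))
      rw [h.inner_B, zero_smul, add_zero] at this
      exact this.symm
    have h3 : ∀ (a : V), (![n, a] : Fin 2 → V) = Function.update ![n, 0] 1 a := by
      intro a
      funext i; fin_cases i <;> simp
    rw [hcons, Fin.sum_univ_one, hcons] at h1
    have h4 : F ![n, B (m k)] = ∑ i, g (m i) (B (m k)) * F ![n, m i] := by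
      rw [h2, h3, F.map_update_add, F.map_update_smul, map_update_sum_smul,
        h.aligned.contract (Function.update _ _ l) 1 (by simp), smul_zero, zero_add, ← h2]
      simp only [← h3]
    rw [h1]
    simp only [Function.update_self]
    rw [h3, F.map_update_add, map_update_sum_smul]
    simp only [← h3, h4, add_mul, Finset.sum_add_distrib]
    rw [add_comm]
  · obtain ⟨q, hq⟩ := Function.ne_iff.1 hne
    have hq' : F ![n, m q] ≠ 0 := hq
    -- The witness comes from solving `cyclic` with third vector `m q`, where `φ'_q ≠ 0`.
    refine ⟨fun j => (g (m q) (B (m j)) - g (m j) (B (m q))) / F ![n, m q], fun i j => ?_⟩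
    have h1 := h.cyclic (h.frame.l_m i) (h.frame.l_m j) (h.frame.l_m q)
    field_simp
    linear_combination -h1

end TwoForm

end Jet

/-! ### Levi-Civita derivatives in a coordinate chart -/

section Coordinates

variable {d : ℕ}

theorem sum_smul_coordVec (v : Coord d) : ∑ i, v i • coordVec d i = v := by
  ext j
  simp [coordVec, Pi.single_apply]

theorem coordVec_ext {φ ψ : Coord d →ₗ[ℝ] ℝ} (h : ∀ i, φ (coordVec d i) = ψ (coordVec d i)) :
    φ = ψ := by
  ext v
  rw [← sum_smul_coordVec v]
  simp only [map_sum, map_smul, h]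

theorem isUnit_det_gram {b : Bil d} (hb : ∀ v, (∀ w, b v w = 0) → v = 0) :
    IsUnit (gram b).det := by
  rw [isUnit_iff_ne_zero]
  intro h0
  obtain ⟨c, hc, hc0⟩ := Matrix.exists_vecMul_eq_zero_iff.2 h0
  apply hc
  have h1 : ∑ i, c i • coordVec d i = 0 := by
    refine hb _ fun w => ?_
    have : (b (∑ i, c i • coordVec d i) : Coord d →ₗ[ℝ] ℝ) = 0 := by
      refine coordVec_ext fun j => ?_
      simpa [Matrix.vecMul, dotProduct, gram] using congrFun hc0 j
    exact LinearMap.congr_fun this w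
  funext j
  have := congrArg (fun v : Coord d => v j) h1
  simpa [coordVec, Pi.single_apply] using this

/-- Raising an index with the inverse of the coordinate matrix of `b`. -/
theorem bil_raise {b : Bil d} (hs : ∀ u v, b u v = b v u) (hb : ∀ v, (∀ w, b v w = 0) → v = 0)
    (φ : Coord d →ₗ[ℝ] ℝ) (w : Coord d) :
    b (∑ i, (∑ j, (gram b)⁻¹ i j * φ (coordVec d j)) • coordVec d i) w = φ w := by
  have : (b (∑ i, (∑ j, (gram b)⁻¹ i j * φ (coordVec d j)) • coordVec d i) : Coord d →ₗ[ℝ] ℝ) =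
      φ := by
    refine coordVec_ext fun k => ?_
    have h1 := congrArg (fun A : Matrix _ _ ℝ => A.mulVec fun j => φ (coordVec d j))
      (Matrix.mul_nonsing_inv _ (isUnit_det_gram hb))
    have h2 := congrFun h1 k
    simp only [← Matrix.mulVec_mulVec, Matrix.one_mulVec] at h2
    rw [← h2]
    simp only [ContinuousLinearMap.coe_coe, map_sum, map_smul, _root_.sum_apply,
      _root_.smul_apply, Matrix.mulVec, dotProduct, gram, Matrix.of_apply, smul_eq_mul]
    refine Finset.sum_congr rfl fun i _ => ?_
    rw [hs, mul_comm]
  exact LinearMap.congr_fun this w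

/-- The inverse metric contracted with the dual of `u` is `u`. -/
theorem sum_inv_gram_inner {b : Bil d} (hs : ∀ u v, b u v = b v u)
    (hb : ∀ v, (∀ w, b v w = 0) → v = 0) (u : Coord d) :
    ∑ i, (∑ j, (gram b)⁻¹ i j * b u (coordVec d j)) • coordVec d i = u := by
  rw [← sub_eq_zero]
  refine hb _ fun w => ?_
  have := bil_raise hs hb (b u : Coord d →ₗ[ℝ] ℝ) w
  simp only [ContinuousLinearMap.coe_coe] at this
  rw [map_sub, _root_.sub_apply, this, sub_self]

theorem IsNullFrame.nondeg {ι : Type*} [Fintype ι] [DecidableEq ι] {b : Bil d}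
    {l n : Coord d} {m : ι → Coord d} (h : IsNullFrame b l n m) (hd : 2 + Fintype.card ι = d)
    {v : Coord d} (hv : ∀ w, b v w = 0) : v = 0 := by
  rw [← h.sum_eq (by simpa using hd) v]
  simp [h.symm _ v, hv]

/-- The inverse metric in terms of a null frame. -/
theorem IsNullFrame.sum_inv_gram {ι : Type*} [Fintype ι] [DecidableEq ι] {b : Bil d}
    {l n : Coord d} {m : ι → Coord d} (h : IsNullFrame b l n m) (hd : 2 + Fintype.card ι = d)
    (t : Coord d →ₗ[ℝ] Coord d →ₗ[ℝ] ℝ) :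
    ∑ i, ∑ j, (gram b)⁻¹ i j * t (coordVec d i) (coordVec d j) =
      t l n + t n l + ∑ k, t (m k) (m k) := by
  have hfin : 2 + Fintype.card ι = Module.finrank ℝ (Coord d) := by simpa using hd
  have hnd : ∀ v, (∀ w, b v w = 0) → v = 0 := fun v hv => h.nondeg hd hv
  have key : ∀ u w, ∑ i, ∑ j, (gram b)⁻¹ i j * (b u (coordVec d j) * t (coordVec d i) w) =
      t u w := by
    intro u w
    conv_rhs => rw [← sum_inv_gram_inner h.symm hnd u]
    simp only [map_sum, map_smul, LinearMap.sum_apply, LinearMap.smul_apply, smul_eq_mul,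
      Finset.sum_mul, mul_assoc]
  -- Expand the second argument in the frame. The coefficient of `l` is the product with `n` and
  -- conversely, whence the crossed terms `t l n` and `t n l`.
  have expand : ∀ i j, (gram b)⁻¹ i j * t (coordVec d i) (coordVec d j) =
      (gram b)⁻¹ i j * (b n (coordVec d j) * t (coordVec d i) l) +
      (gram b)⁻¹ i j * (b l (coordVec d j) * t (coordVec d i) n) +
      ∑ k, (gram b)⁻¹ i j * (b (m k) (coordVec d j) * t (coordVec d i) (m k)) := by
    intro i j
    conv_lhs => rw [← h.sum_eq hfin (coordVec d j)]
    simp only [map_add, map_sum, map_smul, smul_eq_mul, mul_add, Finset.mul_sum]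
  simp only [expand, Finset.sum_add_distrib, key]
  have hc : ∑ i, ∑ j, ∑ k, (gram b)⁻¹ i j * (b (m k) (coordVec d j) * t (coordVec d i) (m k)) =
      ∑ k, t (m k) (m k) := by
    simp only [← key (m _) (m _)]
    rw [Finset.sum_comm (s := Finset.univ (α := ι))]
    exact Finset.sum_congr rfl fun i _ => Finset.sum_comm
  rw [hc]
  ring

variable {G : Coord d → Bil d} {y : Coord d}

set_option synthInstance.maxHeartbeats 200000

/-- `G` is differentiable and nondegenerate at `y`, and symmetric near `y`. -/
structure IsMetricAt (G : Coord d → Bil d) (y : Coord d) : Prop where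
  diff : DifferentiableAt ℝ G y
  symm : ∀ᶠ z in nhds y, ∀ u v, G z u v = G z v u
  nondeg : ∀ v, (∀ w, G y v w = 0) → v = 0

/-- Used to differentiate identities that hold near a point: symmetry of the metric, nullity and
alignment. -/
theorem HasFDerivAt.eq_zero_of_eventually {E F : Type*} [NormedAddCommGroup E] [NormedSpace ℝ E]
    [NormedAddCommGroup F] [NormedSpace ℝ F] {f : E → F} {f' : E →L[ℝ] F} {z : E}
    (hf : HasFDerivAt f f' z) (h : ∀ᶠ x in nhds z, f x = 0) : f' = 0 :=
  hf.unique ((hasFDerivAt_const (0 : F) z).congr_of_eventuallyEq h)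

namespace IsMetricAt

theorem symm_self (h : IsMetricAt G y) (u v : Coord d) : G y u v = G y v u :=
  h.symm.self_of_nhds u v

theorem fderiv_symm (h : IsMetricAt G y) (u v w : Coord d) :
    fderiv ℝ G y u v w = fderiv ℝ G y u w v := by
  have h1 : ∀ a b, HasFDerivAt (fun z => G z a b)
      ((fderiv ℝ G y).flip a |>.flip b) y := fun a b => by
    have := (h.diff.hasFDerivAt.clm_apply (hasFDerivAt_const a y)).clm_apply (hasFDerivAt_const b y)
    refine this.congr_fderiv ?_
    ext u
    simp
  have h2 := HasFDerivAt.eq_zero_of_eventually ((h1 v w).sub (h1 w v))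
    (h.symm.mono fun z hz => by simp [hz v w])
  have h3 := congrArg (fun A : Coord d →L[ℝ] ℝ => A u) h2
  simpa [sub_eq_zero] using h3

/-- The first-kind symbol is a covector in its last argument, so raising and lowering its index
cancel. With nondegeneracy, this gives linearity of `christoffel` and metric compatibility. -/
theorem inner_christoffel (h : IsMetricAt G y) (u v w : Coord d) :
    G y (christoffel G y u v) w = christoffelFirst G y u v w := by
  let φ : Coord d →ₗ[ℝ] ℝ :=
    { toFun := christoffelFirst G y u v
      map_add' := fun a b => by simp [christoffelFirst]; ring
      map_smul' := fun a b => by simp [christoffelFirst]; ring }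
  exact bil_raise h.symm_self h.nondeg φ w

theorem ext (h : IsMetricAt G y) {u v : Coord d} (huv : ∀ w, G y u w = G y v w) : u = v := by
  rw [← sub_eq_zero]
  exact h.nondeg _ fun w => by simp [huv]

theorem christoffel_add_left (h : IsMetricAt G y) (u u' v : Coord d) :
    christoffel G y (u + u') v = christoffel G y u v + christoffel G y u' v :=
  h.ext fun w => by
    simp only [map_add, _root_.add_apply, h.inner_christoffel, christoffelFirst]
    ring

theorem christoffel_smul_left (h : IsMetricAt G y) (c : ℝ) (u v : Coord d) :
    christoffel G y (c • u) v = c • christoffel G y u v :=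
  h.ext fun w => by
    simp only [map_smul, _root_.smul_apply, h.inner_christoffel, christoffelFirst,
      smul_eq_mul]
    ring

theorem christoffel_add_right (h : IsMetricAt G y) (u v v' : Coord d) :
    christoffel G y u (v + v') = christoffel G y u v + christoffel G y u v' :=
  h.ext fun w => by
    simp only [map_add, _root_.add_apply, h.inner_christoffel, christoffelFirst]
    ring

theorem christoffel_smul_right (h : IsMetricAt G y) (c : ℝ) (u v : Coord d) :
    christoffel G y u (c • v) = c • christoffel G y u v :=
  h.ext fun w => by
    simp only [map_smul, _root_.smul_apply, h.inner_christoffel, christoffelFirst,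
      smul_eq_mul]
    ring

/-- The Levi-Civita connection is compatible with the metric. -/
theorem fderiv_eq (h : IsMetricAt G y) (u v w : Coord d) :
    fderiv ℝ G y u v w = G y (christoffel G y u v) w + G y v (christoffel G y u w) := by
  rw [h.symm_self v, h.inner_christoffel, h.inner_christoffel]
  simp only [christoffelFirst]
  linear_combination (-1 / 2 : ℝ) * h.fderiv_symm u w v

/-- The covariant derivative of a vector field as a linear map of the direction. -/
def nablaVecLin (h : IsMetricAt G y) (Y : Coord d → Coord d) : Coord d →ₗ[ℝ] Coord d where
  toFun := nablaVec G Y y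
  map_add' u v := by
    simp only [nablaVec, map_add, h.christoffel_add_left]
    abel
  map_smul' c u := by
    simp only [nablaVec, map_smul, h.christoffel_smul_left, smul_add, RingHom.id_apply]

theorem inner_nablaVec_self (h : IsMetricAt G y) {Y : Coord d → Coord d}
    (hY : DifferentiableAt ℝ Y y) (hnull : ∀ᶠ z in nhds y, G z (Y z) (Y z) = 0) (u : Coord d) :
    G y (Y y) (nablaVec G Y y u) = 0 := by
  have h1 := HasFDerivAt.eq_zero_of_eventually
    ((h.diff.hasFDerivAt.clm_apply hY.hasFDerivAt).clm_apply hY.hasFDerivAt) hnull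
  have h2 := congrArg (fun A : Coord d →L[ℝ] ℝ => A u) h1
  simp [h.fderiv_eq, h.symm_self _ (Y y)] at h2
  simp only [nablaVec, map_add]
  linarith

variable {p : ℕ} {F : Coord d → Alt d (p + 1)}

/-- The covariant derivative of a form as a bilinear map of the direction and the first
argument. -/
def nablaFormLin (h : IsMetricAt G y) (F : Coord d → Alt d (p + 1)) (X : Fin p → Coord d) :
    Coord d →ₗ[ℝ] Coord d →ₗ[ℝ] ℝ :=
  LinearMap.mk₂ ℝ (fun u w => nablaForm G F y u (Fin.cons w X))
    (fun u u' w => by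
      simp only [nablaForm, map_add, ContinuousAlternatingMap.add_apply, h.christoffel_add_left,
        (F y).map_update_add, Finset.sum_add_distrib]
      ring)
    (fun c u w => by
      simp only [nablaForm, map_smul, ContinuousAlternatingMap.smul_apply, h.christoffel_smul_left,
        (F y).map_update_smul, smul_eq_mul, Finset.mul_sum, mul_sub])
    (fun u w w' => by
      have hadd : ∀ (A : Alt d (p + 1)) (Z : Fin p → Coord d) (w w' : Coord d),
          A (Fin.cons (w + w') Z) = A (Fin.cons w Z) + A (Fin.cons w' Z) := fun A Z w w' => by
        have := A.map_update_add (Fin.cons w Z) 0 w w'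
        simpa using this
      simp only [nablaForm, Fin.sum_univ_succ, Fin.cons_zero, Fin.cons_succ, Fin.update_cons_zero,
        ← Fin.cons_update, hadd, h.christoffel_add_right, Finset.sum_add_distrib]
      ring)
    (fun c u w => by
      have hsmul : ∀ (A : Alt d (p + 1)) (Z : Fin p → Coord d) (w : Coord d),
          A (Fin.cons (c • w) Z) = c * A (Fin.cons w Z) := fun A Z w => by
        have := A.map_update_smul (Fin.cons w Z) 0 c w
        simpa using this
      simp only [nablaForm, Fin.sum_univ_succ, Fin.cons_zero, Fin.cons_succ, Fin.update_cons_zero,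
        ← Fin.cons_update, hsmul, h.christoffel_smul_right, smul_eq_mul, ← Finset.mul_sum]
      ring)

theorem divForm_eq {ι : Type*} [Fintype ι] [DecidableEq ι] (h : IsMetricAt G y)
    {l n : Coord d} {m : ι → Coord d} (hf : IsNullFrame (G y) l n m)
    (hd : 2 + Fintype.card ι = d) (X : Fin p → Coord d) :
    divForm G F y X = nablaForm G F y l (Fin.cons n X) + nablaForm G F y n (Fin.cons l X) +
      ∑ i, nablaForm G F y (m i) (Fin.cons (m i) X) :=
  hf.sum_inv_gram hd (h.nablaFormLin F X)

/-- Differentiate `F(…, Y, …) = 0` with the other arguments constant. The Christoffel terms of the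
other slots still contain `Y` and vanish. -/
theorem nablaForm_contract {Y : Coord d → Coord d} (hF : DifferentiableAt ℝ F y)
    (hY : DifferentiableAt ℝ Y y) (hal : ∀ᶠ z in nhds y, IsAligned (G z) (Y z) (F z))
    (u : Coord d) (v : Fin (p + 1) → Coord d) (i : Fin (p + 1)) (hv : v i = Y y) :
    nablaForm G F y u v = -F y (Function.update v i (nablaVec G Y y u)) := by
  have h1 := HasFDerivAt.continuousAlternatingMap_apply hF.hasFDerivAt
    (g := fun j z => Function.update v i (Y z) j)
    (g' := fun j => (Function.update (0 : Fin (p + 1) → (Coord d →L[ℝ] Coord d)) i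
      (fderiv ℝ Y y)) j) (fun j => by
      by_cases hj : j = i
      · subst hj
        simpa using hY.hasFDerivAt
      · simpa [Function.update_of_ne hj] using hasFDerivAt_const (v j) y)
  have h2 := HasFDerivAt.eq_zero_of_eventually h1
    (hal.mono fun z hz => hz.contract _ i (by simp))
  have h3 := congrArg (fun A : Coord d →L[ℝ] ℝ => A u) h2
  have hupd : (fun j => Function.update v i (Y y) j) = v := by rw [← hv, Function.update_eq_self]
  have hself := hal.self_of_nhds
  simp only [hupd, _root_.add_apply, ContinuousLinearMap.coe_comp,
    Function.comp_apply, _root_.sum_apply, _root_.zero_apply] at h3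
  rw [Finset.sum_eq_single i (by
    intro j _ hj
    simp [Function.update_of_ne hj]) (by simp)] at h3
  rw [nablaForm, Finset.sum_eq_single i (by
    intro j _ hj
    exact hself.contract _ i (by rw [Function.update_of_ne hj.symm, hv])) (by simp), hv, nablaVec,
    (F y).map_update_add]
  simp only [Function.update_self] at h3
  change fderiv ℝ F y u v + F y (Function.update v i (fderiv ℝ Y y u)) = 0 at h3
  linear_combination h3

/-- Differentiate the wedge identity with `n` and `v` constant. At `y` both `F v` and the products
`g(Y, v i)` vanish, so one factor of each product remains to be differentiated. -/
theorem nablaForm_orthogonal (h : IsMetricAt G y) {Y : Coord d → Coord d} {n : Coord d}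
    (hF : DifferentiableAt ℝ F y)
    (hY : DifferentiableAt ℝ Y y) (hal : ∀ᶠ z in nhds y, IsAligned (G z) (Y z) (F z))
    (hn : G y (Y y) n = 1) (u : Coord d) (v : Fin (p + 1) → Coord d)
    (hv : ∀ i, G y (Y y) (v i) = 0) :
    nablaForm G F y u v =
      ∑ i, G y (nablaVec G Y y u) (v i) * F y (Function.update v i n) := by
  have hself := hal.self_of_nhds
  have hev : ∀ w : Fin (p + 1) → Coord d,
      HasFDerivAt (fun z => F z w) (ContinuousAlternatingMap.apply ℝ (Coord d) ℝ w ∘L fderiv ℝ F y)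
        y := fun w =>
    (ContinuousAlternatingMap.apply ℝ (Coord d) ℝ w).hasFDerivAt.comp y hF.hasFDerivAt
  have hin : ∀ w : Coord d, HasFDerivAt (fun z => G z (Y z) w) _ y := fun w =>
    (h.diff.hasFDerivAt.clm_apply hY.hasFDerivAt).clm_apply (hasFDerivAt_const w y)
  have h1 := ((hin n).mul (hev v)).sub
    (HasFDerivAt.fun_sum fun i (_ : i ∈ Finset.univ) =>
      (hin (v i)).mul (hev (Function.update v i n)))
  have h2 := HasFDerivAt.eq_zero_of_eventually h1
    (hal.mono fun z hz => sub_eq_zero.2 (hz.wedge n v))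
  have h3 := congrArg (fun A : Coord d →L[ℝ] ℝ => A u) h2
  simp [hn, hv, hself.map_eq_zero_of_orthogonal hn hv] at h3
  -- Only slot `i` can fail to be orthogonal to `Y`, so the wedge identity reduces to one term.
  -- These terms complete the partial derivatives to covariant ones.
  have h4 : ∀ i, F y (Function.update v i (christoffel G y u (v i))) =
      G y (Y y) (christoffel G y u (v i)) * F y (Function.update v i n) := by
    intro i
    have := hself.wedge n (Function.update v i (christoffel G y u (v i)))
    rw [hn, one_mul, Finset.sum_eq_single i (by
      intro j _ hj
      rw [Function.update_of_ne hj, hv, zero_mul]) (by simp), Function.update_self,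
      Function.update_idem] at this
    exact this
  simp only [nablaForm, h4]
  rw [sub_eq_zero] at h3
  rw [h3, ← Finset.sum_sub_distrib]
  refine Finset.sum_congr rfl fun i _ => ?_
  simp only [h.fderiv_eq, nablaVec, map_add, _root_.add_apply]
  ring

theorem isAlignedJet {ι : Type*} [Fintype ι] [DecidableEq ι] (h : IsMetricAt G y)
    {Y : Coord d → Coord d} (hF : DifferentiableAt ℝ F y) (hY : DifferentiableAt ℝ Y y)
    (hnull : ∀ᶠ z in nhds y, G z (Y z) (Y z) = 0)
    (hal : ∀ᶠ z in nhds y, IsAligned (G z) (Y z) (F z))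
    {n : Coord d} {m : ι → Coord d} (hf : IsNullFrame (G y) (Y y) n m)
    (hd : 2 + Fintype.card ι = d) (hdiv : ∀ X, divForm G F y X = 0)
    (hcurl : ∀ w, curlForm G F y w = 0) :
    IsAlignedJet (G y) (Y y) n m (F y) (h.nablaVecLin Y) (nablaForm G F y) where
  frame := hf
  finrank := by simpa using hd
  aligned := hal.self_of_nhds
  inner_B := h.inner_nablaVec_self hY hnull
  T_contract := nablaForm_contract hF hY hal
  T_orthogonal := h.nablaForm_orthogonal hF hY hal hf.l_n
  div X := by rw [← h.divForm_eq hf hd, hdiv]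
  curl := hcurl

end IsMetricAt

end Coordinates

/-! ### Eigenvalues of the symmetric part of the optical matrix. -/

section Eigenvalues

variable {V : Type*} [NormedAddCommGroup V] [NormedSpace ℝ V] {N p : ℕ}
  {g : V →L[ℝ] V →L[ℝ] ℝ} {l n : V} {m : Fin N → V}

/-- Rotating the spatial vectors of a null frame. -/
theorem IsNullFrame.rotate (h : IsNullFrame g l n m)
    (U : OrthonormalBasis (Fin N) ℝ (EuclideanSpace ℝ (Fin N))) :
    IsNullFrame g l n (fun a => ∑ i, U a i • m i) where
  symm := h.symm
  l_l := h.l_l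
  n_n := h.n_n
  l_n := h.l_n
  l_m a := by simp [h.l_m]
  n_m a := by simp [h.n_m]
  m_m a b := by
    have := orthonormal_iff_ite.1 U.orthonormal a b
    rw [PiLp.inner_apply] at this
    simpa [h.m_m, mul_comm] using this

theorem trace_symPart (A : Matrix (Fin N) (Fin N) ℝ) : (symPart A).trace = A.trace := by
  simp only [symPart, Matrix.trace_smul, Matrix.trace_add, Matrix.trace_transpose, smul_eq_mul]
  ring

/-- A non-zero component of `φ'` in the rotated eigenframe has an injective label `K`; the required
set is the image of `K`. -/
theorem IsAlignedJet.exists_eigenvalues {F : V [⋀^Fin (p + 1)]→L[ℝ] ℝ} {B : V →ₗ[ℝ] V}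
    {T : V → (Fin (p + 1) → V) → ℝ} (h : IsAlignedJet g l n m F B T) (hF : F ≠ 0)
    (A : Matrix (Fin N) (Fin N) ℝ) (hA : ∀ i j, A i j = g (m i) (B (m j))) :
    ∃ s : Finset (Fin N), s.card = p ∧
      ∑ i ∈ s, (symPart_isHermitian A).eigenvalues i = A.trace / 2 ∧
      ∑ i ∈ sᶜ, (symPart_isHermitian A).eigenvalues i = A.trace / 2 := by
  set hS := symPart_isHermitian A
  set U := hS.eigenvectorBasis
  have hf := h.frame.rotate U
  obtain ⟨K, hK, hne⟩ := h.aligned.exists_ne_zero hf h.finrank hF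
  have hB : ∀ a i, g (m i) (B (∑ k, U a k • m k)) + g (∑ k, U a k • m k) (B (m i)) =
      2 * hS.eigenvalues a * U a i := by
    intro a i
    have h1 : (symPart A).mulVec (U a) i = hS.eigenvalues a * U a i :=
      congrFun (hS.mulVec_eigenvectorBasis a) i
    simp only [symPart, Matrix.mulVec, dotProduct, Matrix.smul_apply, Matrix.add_apply,
      Matrix.transpose_apply, smul_eq_mul, hA] at h1
    refine Eq.trans ?_ (Eq.trans (congrArg (fun r => 2 * r) h1) (mul_assoc _ _ _).symm)
    simp only [map_sum, map_smul, smul_eq_mul, _root_.sum_apply, _root_.smul_apply,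
      ← Finset.sum_add_distrib, Finset.mul_sum]
    refine Finset.sum_congr rfl fun k _ => ?_
    ring
  -- The trace is still taken in the original frame; the eigenvectors enter only as arguments. The
  -- multiple `b` of `l` is the `l`-component of `B` applied to the eigenvector.
  have hsum := h.sum_eq_trace (X := fun j => ∑ k, U (K j) k • m k) (fun j => hf.l_m (K j))
    (c := fun j => hS.eigenvalues (K j)) (b := fun j => g n (B (∑ k, U (K j) k • m k)))
    (fun j => by
      have h1 := h.frame.sum_eq h.finrank (B (∑ k, U (K j) k • m k))
      rw [h.inner_B, zero_smul, add_zero] at h1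
      conv_lhs => rw [← h1]
      rw [add_assoc, ← Finset.sum_add_distrib, add_comm, Finset.smul_sum]
      simp only [← add_smul, hB, smul_smul]) hne
  have htr : ∑ i, g (m i) (B (m i)) = A.trace := by
    simp [Matrix.trace, hA]
  rw [htr] at hsum
  have hs : ∑ i ∈ Finset.univ.map ⟨K, hK⟩, hS.eigenvalues i = A.trace / 2 := by
    rw [Finset.sum_map]
    exact hsum
  refine ⟨Finset.univ.map ⟨K, hK⟩, by simp, hs, ?_⟩
  have htot : ∑ i, hS.eigenvalues i = A.trace := by
    rw [← trace_symPart A, hS.trace_eq_sum_eigenvalues]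
    simp
  rw [← Finset.sum_add_sum_compl (Finset.univ.map ⟨K, hK⟩), hs] at htot
  linarith

end Eigenvalues

/-! ### From the manifold to the equations at a point. -/

section Spacetime

variable {d p : ℕ} {M : Type*} [TopologicalSpace M] [ChartedSpace (Coord d) M]
  [IsManifold (𝓡 d) ∞ M] {g : LorentzMetric d M} {l : ∀ x : M, TangentSpace (𝓡 d) x}
  {F : ∀ x : M, TangentSpace (𝓡 d) x [⋀^Fin (p + 1)]→L[ℝ] ℝ}

theorem NullFrame.isNullFrame {x : M} {l : TangentSpace (𝓡 d) x} (e : NullFrame g x l) :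
    IsNullFrame (V := Coord d) (g.val x) l e.n e.m where
  symm := g.symm x
  l_l := e.l_l
  n_n := e.n_n
  l_n := e.l_n
  l_m := e.l_m
  n_m := e.n_m
  m_m := e.m_m

theorem MultiplyAligned.isAligned (h : MultiplyAligned g l F) (hd : 2 ≤ d) (x : M) :
    IsAligned (V := Coord d) (g.val x) (l x) (F x) := by
  obtain ⟨e, he⟩ := h x
  exact e.isNullFrame.isAligned (by simp; omega) indexBoost rfl rfl (fun _ => rfl) he

/-- Alignment pulls back along `chartTangent`. It is needed on the whole chart target because it
gets differentiated at the centre. -/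
theorem MultiplyAligned.isAligned_inChart (h : MultiplyAligned g l F) (hd : 2 ≤ d) (x : M)
    {y : Coord d} (hy : y ∈ (extChartAt (𝓡 d) x).target) :
    IsAligned (bilInChart g.val x y) (vecInChart l x y) (formInChart F x y) := by
  have hx := h.isAligned hd ((extChartAt (𝓡 d) x).symm y)
  constructor
  · intro v i hv
    rw [formInChart_apply]
    exact hx.contract _ i (by rw [hv]; exact chartTangent_vecInChart l x hy)
  · intro w v
    have h1 := hx.wedge (chartTangent x y w) (fun i => chartTangent x y (v i))
    simp only [bilInChart_apply, formInChart_apply, chartTangent_vecInChart l x hy]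
    refine h1.trans (Finset.sum_congr rfl fun i _ => congrArg₂ _ rfl (congrArg _ ?_))
    exact (Function.comp_update (chartTangent x y) v i w).symm

/-- The frame `e` is arbitrary: `IsAligned` no longer refers to the frame in which alignment was
given. -/
theorem isAlignedJet_of_isMaxwell (hd : 2 ≤ d) (hl : IsNullField g l) (hF : IsMaxwell g F)
    (hlF : MultiplyAligned g l F) (x : M) (e : NullFrame g x (l x)) :
    ∃ (B : Coord d →ₗ[ℝ] Coord d) (T : Coord d → (Fin (p + 1) → Coord d) → ℝ),
      (∀ u, B u = nabla g l x u) ∧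
      IsAlignedJet (V := Coord d) (g.val x) (l x) e.n e.m (F x) B T := by
  have hd' : 2 + Fintype.card (Fin (d - 2)) = d := by simp; omega
  have eg : bilInChart g.val x (extChartAt (𝓡 d) x x) = (g.val x : Bil d) := by
    ext u v
    exact bilInChart_self g.val x u v
  have eF : formInChart F x (extChartAt (𝓡 d) x x) = (F x : Alt d (p + 1)) := by
    ext v
    exact formInChart_self F x v
  have el := vecInChart_self (d := d) l x
  have hmet : IsMetricAt (bilInChart g.val x) (extChartAt (𝓡 d) x x) :=
    ⟨differentiableAt_bilInChart g.smooth x,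
      Filter.Eventually.of_forall fun z u v => g.symm _ _ _,
      fun v hv => e.isNullFrame.nondeg hd' (by rw [eg] at hv; exact hv)⟩
  refine ⟨hmet.nablaVecLin (vecInChart l x), nablaForm (bilInChart g.val x) (formInChart F x)
    (extChartAt (𝓡 d) x x), fun _ => rfl, ?_⟩
  have hmem := eventually_mem_extChartAt_target (d := d) x
  have key := hmet.isAlignedJet (differentiableAt_formInChart hF.smooth x)
    (differentiableAt_vecInChart hl.smooth x)
    (hmem.mono fun z hz => by
      rw [bilInChart_apply, chartTangent_vecInChart l x hz]
      exact hl.null _)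
    (hmem.mono fun z hz => hlF.isAligned_inChart hd x hz)
    (n := e.n) (m := e.m) (by rw [eg, el]; exact e.isNullFrame) hd' (hF.div_eq_zero x)
    (hF.curl_eq_zero x)
  -- At the centre of the chart, coordinate expressions are the fields themselves.
  rw [eg, eF, el] at key
  exact key

end Spacetime

end NullAlign

end

theorem mainTheorem9 (d p : ℕ) (hp : 0 < p) (hpd : p + 2 < d)
    (M : Type*) [TopologicalSpace M] [ChartedSpace (NullAlign.Coord d) M]
    [IsManifold (𝓡 d) ∞ M]
    (g : NullAlign.LorentzMetric d M)
    (l : ∀ x : M, TangentSpace (𝓡 d) x) (hl : NullAlign.IsNullField g l)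
    (F : ∀ x : M, TangentSpace (𝓡 d) x [⋀^Fin (p + 1)]→L[ℝ] ℝ) (hF : NullAlign.IsMaxwell g F)
    (hlF : NullAlign.MultiplyAligned g l F)
    (x : M) (hx : F x ≠ 0) :
    -- `l` is geodesic
    NullAlign.GeodesicAt g l x ∧
    ∀ e : NullAlign.NullFrame g x (l x),
      -- `p` eigenvalues of the symmetric part of the optical matrix sum to half its trace, and so
      -- do the remaining ones
      (∃ s : Finset (Fin (d - 2)), s.card = p ∧
        ∑ i ∈ s, (NullAlign.symPart_isHermitian (NullAlign.opticalMatrix g l x e)).eigenvalues i =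
          (NullAlign.opticalMatrix g l x e).trace / 2 ∧
        ∑ i ∈ sᶜ, (NullAlign.symPart_isHermitian (NullAlign.opticalMatrix g l x e)).eigenvalues i =
          (NullAlign.opticalMatrix g l x e).trace / 2) ∧
      -- the case of a two-form field
      (p = 1 →
        (fun i => NullAlign.phiPrime e (F x) (fun _ => i)) ≠ 0 ∧
        (NullAlign.symPart (NullAlign.opticalMatrix g l x e)).mulVec
            (fun i => NullAlign.phiPrime e (F x) (fun _ => i)) =
          ((NullAlign.opticalMatrix g l x e).trace / 2) •
            (fun i => NullAlign.phiPrime e (F x) (fun _ => i)) ∧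
        ∃ w : Fin (d - 2) → ℝ, ∀ i j,
          NullAlign.antisymPart (NullAlign.opticalMatrix g l x e) i j =
            (1 / 2 : ℝ) * (NullAlign.phiPrime e (F x) (fun _ => i) * w j -
              NullAlign.phiPrime e (F x) (fun _ => j) * w i)) := by
  have hd : 2 ≤ d := by omega
  constructor
  · obtain ⟨e, -⟩ := hlF x
    obtain ⟨B, T, hB, h⟩ := NullAlign.isAlignedJet_of_isMaxwell hd hl hF hlF x e
    exact ⟨_, (hB (l x)).symm.trans (h.B_l hx)⟩
  · intro e
    obtain ⟨B, T, hB, h⟩ := NullAlign.isAlignedJet_of_isMaxwell hd hl hF hlF x e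
    have hA : ∀ i j, NullAlign.opticalMatrix g l x e i j = g.val x (e.m i) (B (e.m j)) :=
      fun i j => congrArg (g.val x (e.m i)) (hB (e.m j)).symm
    refine ⟨h.exists_eigenvalues hx _ hA, ?_⟩
    rintro rfl
    obtain ⟨h1, h2, w, hw⟩ := h.two_form hx
    have hphi : ∀ i, NullAlign.phiPrime e (F x) (fun _ => i) = F x ![e.n, e.m i] := by
      intro i
      refine congrArg (F x) ?_
      funext j
      fin_cases j <;> rfl
    have h2' : ∀ k, ∑ i, (NullAlign.opticalMatrix g l x e k i + NullAlign.opticalMatrix g l x e i k) *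
        F x ![e.n, e.m i] = (∑ i, NullAlign.opticalMatrix g l x e i i) * F x ![e.n, e.m k] :=
      fun k => by simp only [hA]; exact h2 k
    have hw' : ∀ i j, NullAlign.opticalMatrix g l x e i j - NullAlign.opticalMatrix g l x e j i =
        F x ![e.n, e.m i] * w j - F x ![e.n, e.m j] * w i :=
      fun i j => by simp only [hA]; exact hw i j
    simp only [hphi]
    refine ⟨h1, ?_, w, fun i j => ?_⟩
    · funext k
      simp only [NullAlign.symPart, Matrix.mulVec, dotProduct, Matrix.smul_apply, Matrix.add_apply,
        Matrix.transpose_apply, smul_eq_mul, Pi.smul_apply, Matrix.trace, Matrix.diag_apply,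
        mul_assoc, ← Finset.mul_sum]
      rw [h2']
      ring
    · simp only [NullAlign.antisymPart, Matrix.smul_apply, Matrix.sub_apply,
        Matrix.transpose_apply, smul_eq_mul]
      rw [hw']
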